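/- Let $\mathfrak A$ be a complex unital Banach algebra (for instance the bounded operators on a complex Hilbert space, or complex matrices with the operator norm). For $A,B\in\mathfrak A$, $0<\alpha\le 1$ and $\lambda\in\mathbb C$ put $H=A+\alpha B$, $\mathrm{ad}_A(X)=AX-XA$, and let $$S_2(\lambda)=e^{\lambda A/2}\,e^{\alpha\lambda B}\,e^{\lambda A/2}$$ be the second-order product formula (Strang splitting). For an integer $k\ge 1$ define the symplectic corrector and the corrected product formula $$C(k)=\alpha\sum_{j=1}^{k}\frac{B_{2j}(1/2)}{(2j)!}\,\lambda^{2j}\,\mathrm{ad}_A^{2j-1}(B),\qquad S_2^c(\lambda)=e^{C(k)}S_2(\lambda)e^{-C(k)},$$ where $B_n(x)$ are the Bernoulli polynomials, $\frac{te^{tx}}{e^t-1}=\sum_{n\ge0}B_n(x)\frac{t^n}{n!}$. Then for every $k\ge1$ and every $M\ge 0$ there is a constant $K$ (depending only on $\mathfrak A$, $k$ and $M$) such that for all $A,B\in\mathfrak A$ with $\|A\|,\|B\|\le M$, all $0<\alpha\le1$ and all $\lambda\in\mathbb C$ with $|\lambda|<1$, $$\bigl\|e^{\lambda H}-S_2^c(\lambda)\bigr\|\le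 K\left(\alpha^2|\lambda|^3+\alpha|\lambda|^{2k+3}\right).$$ -/

import Mathlib

open scoped Nat

noncomputable section

namespace CorrectedPF

variable {𝔸 : Type*} [NormedRing 𝔸] [NormedAlgebra ℂ 𝔸]

/-- The commutator map `ad_A(X) = [A, X] = A X - X A`. -/
def ad (A X : 𝔸) : 𝔸 := A * X - X * A

/-- The Hamiltonian `H = A + α B` of the perturbed system. -/
def hamiltonian (A B : 𝔸) (α : ℝ) : 𝔸 := A + (α : ℂ) • B

/-- The second-order product formula (Strang splitting)
`S₂(z) = exp (z A / 2) exp (α z B) exp (z A / 2)`. -/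
def S₂ (A B : 𝔸) (α : ℝ) (z : ℂ) : 𝔸 :=
  NormedSpace.exp ((z / 2) • A) * NormedSpace.exp (((α : ℂ) * z) • B) *
    NormedSpace.exp ((z / 2) • A)

/-- The symplectic corrector
`C(k) = α ∑_{j=1}^k B_{2j}(1/2) / (2j)! z^{2j} ad_A^{2j-1}(B)`, where `B_n(x)` are the Bernoulli
polynomials. -/
def corrector (A B : 𝔸) (α : ℝ) (k : ℕ) (z : ℂ) : 𝔸 :=
  (α : ℂ) • ∑ j ∈ Finset.Icc 1 k,
    ((((Polynomial.bernoulli (2 * j)).eval (1 / 2 : ℚ) : ℚ) : ℂ) / ((2 * j)! : ℂ) * z ^ (2 * j)) •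
      (ad A)^[2 * j - 1] B

/-- The corrected product formula `exp (C(k)) S₂(z) exp (-C(k))`. -/
def correctedS₂ (A B : 𝔸) (α : ℝ) (k : ℕ) (z : ℂ) : 𝔸 :=
  NormedSpace.exp (corrector A B α k z) * S₂ A B α z * NormedSpace.exp (-corrector A B α k z)

end CorrectedPF

end

/-!
For fixed `X = z A` and `Y = z B` the error, as a function of the coupling `α`, extends to an entire
function of a complex variable and vanishes at `α = 0`. The Strang splitting has second order, and
conjugation by `exp C` with `C = O(|z|²)` does not affect this, so the error is `O(|z|³)` uniformly
for `α` in a disc. The Schwarz lemma in `α` then bounds everything beyond the part linear in `α` by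
`O(α²|z|³)`.

The linear part is `α f(ad X) Y e^X` with `f(t) = (e^t - 1) / t - e^{t/2} - (1 - e^t) p(t)`, where
`p` is the polynomial of the corrector. Since `t e^{t/2} / (e^t - 1) = ∑ B_n(1/2) t^n / n!`, whose
odd coefficients vanish, the choice of `p` as a truncation makes `f` vanish to order `2k + 2` at
`0`, and the linear part is `O(α|z|^{2k+3})`.
-/

namespace CorrectedPF

open Asymptotics Filter Finset PowerSeries

section BernoulliSeries

/-- The polynomial `∑_{j=1}^k B_{2j}(1/2) / (2j)! X^{2j-1}`: the corrector is its value at `ad_A`,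
up to the scaling by `α` and `z`. -/
noncomputable def correctorPoly (k : ℕ) : Polynomial ℂ :=
  ∑ j ∈ Icc 1 k, Polynomial.C ((((Polynomial.bernoulli (2 * j)).eval (1 / 2 : ℚ) : ℚ) : ℂ) /
    ((2 * j)! : ℂ)) * Polynomial.X ^ (2 * j - 1)

/-- The series `∑ B_n(1/2) / n! X^n` of `X e^{X/2} / (e^X - 1)`, which
`1 + X * correctorPoly k` truncates. -/
noncomputable def midpointBernoulliSeries : ℂ⟦X⟧ :=
  mk fun n => (((Polynomial.bernoulli n).eval (1 / 2 : ℚ) : ℚ) : ℂ) / (n ! : ℂ)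

/-- The series `∑ X^n / (n+1)!` of `(e^X - 1) / X`: its value at `ad X` governs the derivative of
the exponential at `X`. -/
noncomputable def phiSeries : ℂ⟦X⟧ := mk fun n => ((n + 1)! : ℂ)⁻¹

theorem X_mul_phiSeries : X * phiSeries = PowerSeries.exp ℂ - 1 := by
  ext n
  cases n with
  | zero => simp
  | succ n => simp [phiSeries, coeff_succ_X_mul, PowerSeries.coeff_one]

theorem midpointBernoulliSeries_mul_exp_sub_one :
    midpointBernoulliSeries * (PowerSeries.exp ℂ - 1) =
      X * rescale (1 / 2 : ℂ) (PowerSeries.exp ℂ) := by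
  rw [← Polynomial.bernoulli_generating_function]
  congr 2
  ext n
  have h : (1 / 2 : ℂ) = algebraMap ℚ ℂ (1 / 2) := by simp
  rw [midpointBernoulliSeries, coeff_mk, coeff_mk, h, Polynomial.aeval_algebraMap_apply,
    Polynomial.coe_aeval_eq_eval, Polynomial.eval_smul]
  simp [div_eq_inv_mul]

theorem bernoulli_eval_half_of_odd {n : ℕ} (hn : Odd n) :
    (Polynomial.bernoulli n).eval (1 / 2 : ℚ) = 0 := by
  have h := Polynomial.bernoulli_eval_one_sub n (1 / 2)
  rw [hn.neg_one_pow] at h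
  norm_num at h ⊢
  linarith

theorem coeff_correctorPoly {k n : ℕ} (hn : n ≤ 2 * k) :
    (correctorPoly k).coeff n = coeff (n + 1) midpointBernoulliSeries := by
  simp only [correctorPoly, Polynomial.finsetSum_coeff, Polynomial.coeff_C_mul_X_pow,
    midpointBernoulliSeries, coeff_mk]
  rcases Nat.even_or_odd' (n + 1) with ⟨m, hm | hm⟩
  · rw [sum_eq_single_of_mem m (by rw [mem_Icc]; omega) fun j hj hjm => ?_, if_pos (by omega), hm]
    rw [mem_Icc] at hj
    exact if_neg (by omega)
  · rw [bernoulli_eval_half_of_odd ⟨m, hm⟩, Rat.cast_zero, zero_div]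
    refine sum_eq_zero fun j hj => if_neg ?_
    rw [mem_Icc] at hj
    omega

theorem X_pow_dvd_one_add_X_mul_correctorPoly_sub (k : ℕ) :
    X ^ (2 * k + 2) ∣ 1 + X * (correctorPoly k : ℂ⟦X⟧) - midpointBernoulliSeries := by
  rw [X_pow_dvd_iff]
  intro n hn
  cases n with
  | zero => simp [midpointBernoulliSeries]
  | succ n =>
    simp [coeff_succ_X_mul, coeff_correctorPoly (show n ≤ 2 * k by omega), PowerSeries.coeff_one]

theorem X_dvd_correctorPoly (k : ℕ) : (Polynomial.X : Polynomial ℂ) ∣ correctorPoly k :=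
  dvd_sum fun j hj => (dvd_pow_self _ (by rw [mem_Icc] at hj; omega)).mul_left _

/-- The first-order error series `(e^X - 1) / X - e^{X/2} - (1 - e^X) p(X)`: the part linear in `Y`
of the error of the splitting corrected by `p(ad X) Y` is this series at `ad X`, applied to `Y`. -/
noncomputable def firstOrderSeries (p : Polynomial ℂ) : ℂ⟦X⟧ :=
  phiSeries - rescale (1 / 2 : ℂ) (PowerSeries.exp ℂ) - (1 - PowerSeries.exp ℂ) * p

theorem X_pow_dvd_firstOrderSeries (k : ℕ) :
    X ^ (2 * k + 2) ∣ firstOrderSeries (correctorPoly k) := by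
  have h : firstOrderSeries (correctorPoly k) =
      phiSeries * (1 + X * (correctorPoly k : ℂ⟦X⟧) - midpointBernoulliSeries) := by
    apply mul_left_cancel₀ (X_ne_zero : (X : ℂ⟦X⟧) ≠ 0)
    rw [firstOrderSeries]
    linear_combination (midpointBernoulliSeries - X * (correctorPoly k : ℂ⟦X⟧)) * X_mul_phiSeries +
      midpointBernoulliSeries_mul_exp_sub_one
  exact h ▸ (X_pow_dvd_one_add_X_mul_correctorPoly_sub k).mul_left _

end BernoulliSeries

section EntireSeries

variable {𝕜 R : Type*} [NormedField 𝕜] [NormedRing R] [NormedAlgebra 𝕜 R] {f g : 𝕜⟦X⟧}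

/-- A formal power series is entire if it converges absolutely at every radius. -/
def IsEntire (f : 𝕜⟦X⟧) : Prop := ∀ r : ℝ, Summable fun n => ‖coeff n f‖ * r ^ n

/-- The value `∑ aₙ xⁿ` of a power series with scalar coefficients at an element of an algebra;
meaningful when the series is entire. -/
noncomputable def evalSeries (f : 𝕜⟦X⟧) (x : R) : R := ∑' n, coeff n f • x ^ n

theorem norm_pow_le_max_mul {R : Type*} [SeminormedRing R] (x : R) (n : ℕ) :
    ‖x ^ n‖ ≤ max 1 ‖(1 : R)‖ * ‖x‖ ^ n := by
  rcases n.eq_zero_or_pos with rfl | hn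
  · simp
  · exact (norm_pow_le' x hn).trans (le_mul_of_one_le_left (by positivity) (le_max_left _ _))

theorem norm_smul_pow_le (a : 𝕜) {x : R} {r : ℝ} (hx : ‖x‖ ≤ r) (n : ℕ) :
    ‖a • x ^ n‖ ≤ max 1 ‖(1 : R)‖ * (‖a‖ * r ^ n) := calc
  ‖a • x ^ n‖ ≤ ‖a‖ * (max 1 ‖(1 : R)‖ * ‖x‖ ^ n) :=
    (norm_smul_le _ _).trans (by gcongr; exact norm_pow_le_max_mul x n)
  _ ≤ ‖a‖ * (max 1 ‖(1 : R)‖ * r ^ n) := by gcongr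
  _ = max 1 ‖(1 : R)‖ * (‖a‖ * r ^ n) := by ring

theorem IsEntire.summable_norm (hf : IsEntire f) (x : R) :
    Summable fun n => ‖coeff n f • x ^ n‖ :=
  ((hf ‖x‖).mul_left _).of_nonneg_of_le (fun _ => norm_nonneg _)
    fun n => norm_smul_pow_le _ le_rfl n

theorem IsEntire.hasSum [CompleteSpace R] (hf : IsEntire f) (x : R) :
    HasSum (fun n => coeff n f • x ^ n) (evalSeries f x) :=
  (hf.summable_norm x).of_norm.hasSum

theorem isEntire_coe (p : Polynomial 𝕜) : IsEntire (p : 𝕜⟦X⟧) := fun r =>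
  summable_of_ne_finset_zero (s := range (p.natDegree + 1)) fun n hn => by
    rw [Polynomial.coeff_coe, Polynomial.coeff_eq_zero_of_natDegree_lt (by simpa using hn)]
    simp

theorem IsEntire.sub (hf : IsEntire f) (hg : IsEntire g) : IsEntire (f - g) := fun r => by
  refine (((hf |r|).add (hg |r|)).of_norm_bounded (fun n => ?_))
  rw [norm_mul, norm_norm, norm_pow, Real.norm_eq_abs, ← add_mul, map_sub]
  gcongr
  exact norm_sub_le _ _

theorem IsEntire.mul (hf : IsEntire f) (hg : IsEntire g) : IsEntire (f * g) := fun r => by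
  have hfg := summable_norm_sum_mul_antidiagonal_of_summable_norm (R := ℝ)
    (f := fun n => ‖coeff n f‖ * r ^ n) (g := fun n => ‖coeff n g‖ * r ^ n)
    (hf r).norm (hg r).norm
  refine hfg.of_norm_bounded fun n => ?_
  have hsum : ∑ kl ∈ antidiagonal n, ‖coeff kl.1 f‖ * r ^ kl.1 * (‖coeff kl.2 g‖ * r ^ kl.2) =
      (∑ kl ∈ antidiagonal n, ‖coeff kl.1 f‖ * ‖coeff kl.2 g‖) * r ^ n := by
    rw [sum_mul]
    refine sum_congr rfl fun kl hkl => ?_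
    rw [← mem_antidiagonal.mp hkl, pow_add]
    ring
  rw [hsum, norm_mul, norm_mul, norm_norm, coeff_mul]
  gcongr
  exact (norm_sum_le _ _).trans <| (sum_le_sum fun kl _ => norm_mul_le _ _).trans (le_abs_self _)

theorem IsEntire.rescale (hf : IsEntire f) (c : 𝕜) : IsEntire (rescale c f) := fun r => by
  refine (hf (‖c‖ * r)).congr fun n => ?_
  rw [coeff_rescale, norm_mul, norm_pow, mul_pow]
  ring

theorem IsEntire.of_X_pow_mul {m : ℕ} (h : IsEntire (X ^ m * f)) : IsEntire f := fun r => by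
  rcases eq_or_ne r 0 with rfl | hr
  · exact summable_of_ne_finset_zero (s := {0}) fun n hn => by
      rw [zero_pow (by simpa using hn), mul_zero]
  · have h' := (h r).comp_injective (add_left_injective m)
    refine (h'.mul_left (r ^ m)⁻¹).congr fun n => ?_
    simp only [Function.comp_apply, coeff_X_pow_mul, pow_add]
    field_simp

theorem evalSeries_coe (p : Polynomial 𝕜) (x : R) :
    evalSeries (p : 𝕜⟦X⟧) x = Polynomial.aeval x p := by
  rw [evalSeries, Polynomial.aeval_eq_sum_range]
  simp only [Polynomial.coeff_coe]
  refine tsum_eq_sum fun n hn => ?_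
  rw [Polynomial.coeff_eq_zero_of_natDegree_lt (by simpa using hn), zero_smul]

theorem evalSeries_rescale (c : 𝕜) (f : 𝕜⟦X⟧) (x : R) :
    evalSeries (rescale c f) x = evalSeries f (c • x) := by
  refine tsum_congr fun n => ?_
  rw [coeff_rescale, smul_pow, smul_smul, mul_comm]

variable {ι : Type*} {l : Filter ι} {x : ι → R} {t : ι → ℝ}

theorem IsEntire.isBigO_one (hf : IsEntire f) (hx : x =O[l] fun _ => (1 : ℝ)) :
    (fun i => evalSeries f (x i)) =O[l] fun _ => (1 : ℝ) := by
  obtain ⟨r, hr⟩ := hx.bound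
  refine IsBigO.of_bound (max 1 ‖(1 : R)‖ * ∑' n, ‖coeff n f‖ * r ^ n) ?_
  filter_upwards [hr] with i hi
  rw [norm_one (α := ℝ), mul_one] at hi ⊢
  rw [← tsum_mul_left]
  exact tsum_of_norm_bounded ((hf r).mul_left _).hasSum fun n => norm_smul_pow_le _ hi n

variable [CompleteSpace R]

theorem evalSeries_sub (hf : IsEntire f) (hg : IsEntire g) (x : R) :
    evalSeries (f - g) x = evalSeries f x - evalSeries g x := by
  refine ((hf.hasSum x).sub (hg.hasSum x)).tsum_eq ▸ tsum_congr fun n => ?_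
  rw [map_sub, sub_smul]

theorem evalSeries_mul (hf : IsEntire f) (hg : IsEntire g) (x : R) :
    evalSeries (f * g) x = evalSeries f x * evalSeries g x := by
  rw [evalSeries, evalSeries, evalSeries, tsum_mul_tsum_eq_tsum_sum_antidiagonal_of_summable_norm
    (hf.summable_norm x) (hg.summable_norm x)]
  refine tsum_congr fun n => ?_
  rw [coeff_mul, sum_smul]
  refine sum_congr rfl fun kl hkl => ?_
  rw [smul_mul_smul_comm, ← pow_add, mem_antidiagonal.mp hkl]

theorem IsEntire.isBigO_pow_of_X_pow_dvd (hf : IsEntire f) {m : ℕ} (hm : X ^ m ∣ f)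
    (hx : x =O[l] t) (ht : t =O[l] fun _ => (1 : ℝ)) :
    (fun i => evalSeries f (x i)) =O[l] fun i => t i ^ m := by
  obtain ⟨g, rfl⟩ := hm
  have hg : IsEntire g := hf.of_X_pow_mul
  have hX : IsEntire ((Polynomial.X ^ m : Polynomial 𝕜) : 𝕜⟦X⟧) := isEntire_coe _
  have heval : ∀ y : R, evalSeries (X ^ m * g) y = y ^ m * evalSeries g y := fun y => by
    rw [← Polynomial.coe_X, ← Polynomial.coe_pow, evalSeries_mul hX hg, evalSeries_coe, map_pow,
      Polynomial.aeval_X]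
  simpa [heval] using (hx.pow m).mul (hg.isBigO_one (hx.trans ht))

end EntireSeries

section Exp

variable {R : Type*} [NormedRing R] [NormedAlgebra ℂ R]

theorem isEntire_exp : IsEntire (PowerSeries.exp ℂ) := fun r =>
  (Real.summable_pow_div_factorial r).congr fun n => by simp [coeff_exp, div_eq_inv_mul]

theorem isEntire_phiSeries : IsEntire phiSeries := by
  refine IsEntire.of_X_pow_mul (m := 1) ?_
  rw [pow_one, X_mul_phiSeries, ← Polynomial.coe_one]
  exact isEntire_exp.sub (isEntire_coe 1)

theorem evalSeries_exp (x : R) : evalSeries (PowerSeries.exp ℂ) x = NormedSpace.exp x := by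
  rw [NormedSpace.exp_eq_tsum ℂ]
  exact tsum_congr fun n => by simp [coeff_exp]

theorem isEntire_firstOrderSeries (p : Polynomial ℂ) : IsEntire (firstOrderSeries p) := by
  rw [firstOrderSeries, ← Polynomial.coe_one]
  exact (isEntire_phiSeries.sub (isEntire_exp.rescale _)).sub
    (((isEntire_coe _).sub isEntire_exp).mul (isEntire_coe p))

variable [CompleteSpace R]

theorem evalSeries_firstOrderSeries (p : Polynomial ℂ) (x : R) :
    evalSeries (firstOrderSeries p) x = evalSeries phiSeries x -
      NormedSpace.exp ((1 / 2 : ℂ) • x) - (1 - NormedSpace.exp x) * Polynomial.aeval x p := by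
  have hone := isEntire_coe (1 : Polynomial ℂ)
  rw [firstOrderSeries, ← Polynomial.coe_one,
    evalSeries_sub (isEntire_phiSeries.sub (isEntire_exp.rescale _))
      ((hone.sub isEntire_exp).mul (isEntire_coe p)),
    evalSeries_sub isEntire_phiSeries (isEntire_exp.rescale _),
    evalSeries_mul (hone.sub isEntire_exp) (isEntire_coe p), evalSeries_sub hone isEntire_exp,
    evalSeries_rescale, evalSeries_exp, evalSeries_exp, evalSeries_coe, evalSeries_coe, map_one]

variable {ι : Type*} {l : Filter ι} {x : ι → R} {t : ι → ℝ}

theorem isBigO_exp_sub_aeval_trunc (hx : x =O[l] t) (ht : t =O[l] fun _ => (1 : ℝ)) (m : ℕ) :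
    (fun i => NormedSpace.exp (x i) - Polynomial.aeval (x i) (trunc m (PowerSeries.exp ℂ)))
      =O[l] fun i => t i ^ m := by
  have hdvd : X ^ m ∣ PowerSeries.exp ℂ - (trunc m (PowerSeries.exp ℂ) : ℂ⟦X⟧) :=
    X_pow_dvd_iff.mpr fun n hn => by
      rw [map_sub, Polynomial.coeff_coe, coeff_trunc, if_pos hn, sub_self]
  have hentire := isEntire_exp.sub (isEntire_coe (trunc m (PowerSeries.exp ℂ)))
  simpa only [evalSeries_sub isEntire_exp (isEntire_coe _), evalSeries_exp, evalSeries_coe]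
    using hentire.isBigO_pow_of_X_pow_dvd hdvd hx ht

end Exp

section Commutator

variable {𝔸 : Type*} [NormedRing 𝔸] [NormedAlgebra ℂ 𝔸]

/-- The commutator `(X, Y) ↦ [X, Y]` as a continuous bilinear map, so that power series can be
evaluated at the operators `adCLM X`. -/
noncomputable def adCLM : 𝔸 →L[ℂ] 𝔸 →L[ℂ] 𝔸 :=
  ContinuousLinearMap.mul ℂ 𝔸 - (ContinuousLinearMap.mul ℂ 𝔸).flip

theorem adCLM_pow_apply (X Y : 𝔸) (n : ℕ) : (adCLM X ^ n) Y = (ad X)^[n] Y := by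
  rw [FunLike.coe_pow_eq_iterate]
  rfl

theorem ad_smul_iterate (c : ℂ) (X Y : 𝔸) (n : ℕ) :
    (ad (c • X))^[n] Y = c ^ n • (ad X)^[n] Y := by
  induction n with
  | zero => simp
  | succ n ih =>
    rw [Function.iterate_succ_apply', Function.iterate_succ_apply', ih, ad, ad, smul_mul_smul_comm,
      smul_mul_smul_comm, mul_comm c, ← smul_sub, ← pow_succ]

theorem pow_mul_eq_sum_ad (X Y : 𝔸) (n : ℕ) :
    X ^ n * Y = ∑ m ∈ antidiagonal n, n.choose m.1 • ((ad X)^[m.1] Y * X ^ m.2) := by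
  set L : 𝔸 →L[ℂ] 𝔸 := ContinuousLinearMap.mul ℂ 𝔸 X
  set R : 𝔸 →L[ℂ] 𝔸 := (ContinuousLinearMap.mul ℂ 𝔸).flip X
  have hL : (L ^ n) Y = X ^ n * Y := by
    rw [FunLike.coe_pow_eq_iterate]
    exact congr_fun (mul_left_iterate X n) Y
  have hR : ∀ (m : ℕ) (Z : 𝔸), (R ^ m) Z = Z * X ^ m := fun m Z => by
    rw [FunLike.coe_pow_eq_iterate]
    exact congr_fun (mul_right_iterate X m) Z
  have hcomm : Commute R (adCLM X) := by
    ext Z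
    simp [R, adCLM, mul_assoc, mul_sub, sub_mul]
  have hadd : L = adCLM X + R := (sub_add_cancel L R).symm
  rw [← hL, hadd, hcomm.symm.add_pow', _root_.sum_apply]
  refine sum_congr rfl fun m _ => ?_
  rw [(hcomm.symm.pow_pow _ _).eq, smul_apply, mul_apply_eq_comp,
    hR, adCLM_pow_apply]

theorem sum_pow_mul_mul_pow_eq_sum_ad (X Y : 𝔸) (n : ℕ) :
    ∑ i ∈ range (n + 1), X ^ (n - i) * Y * X ^ i =
      ∑ m ∈ antidiagonal n, (n + 1).choose (m.1 + 1) • ((ad X)^[m.1] Y * X ^ m.2) := by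
  induction n with
  | zero => simp
  | succ n ih =>
    have hchoose (m : ℕ × ℕ) : (n + 2).choose (m.1 + 1) • ((ad X)^[m.1] Y * X ^ m.2) =
        (n + 1).choose m.1 • ((ad X)^[m.1] Y * X ^ m.2) +
          (n + 1).choose (m.1 + 1) • ((ad X)^[m.1] Y * X ^ m.2) := by
      rw [← add_smul, Nat.choose_succ_succ]
    rw [sum_range_succ', sum_congr rfl fun m _ => hchoose m, sum_add_distrib,
      ← pow_mul_eq_sum_ad, Nat.sum_antidiagonal_succ', Nat.choose_succ_self, zero_smul, zero_add]
    simp only [Nat.add_sub_add_right, pow_succ X, ← mul_assoc, ← sum_mul, ih]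
    simp only [sum_mul, smul_mul_assoc, Nat.sub_zero, pow_zero, mul_one, pow_succ X, mul_assoc]
    rw [add_comm]

end Commutator

section ExpDerivative

variable {𝔸 : Type*} [NormedRing 𝔸] [NormedAlgebra ℂ 𝔸]

theorem hasDerivAt_inv_factorial_smul_add_smul_pow (X Y : 𝔸) (n : ℕ) :
    HasDerivAt (fun ζ : ℂ => ((n + 1)! : ℂ)⁻¹ • (X + ζ • Y) ^ (n + 1))
      (∑ m ∈ antidiagonal n,
        (coeff m.1 phiSeries * (m.2 ! : ℂ)⁻¹) • ((ad X)^[m.1] Y * X ^ m.2)) 0 := by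
  have hlin : HasDerivAt (fun ζ : ℂ => X + ζ • Y) Y 0 := by
    simpa using ((hasDerivAt_id (0 : ℂ)).smul_const Y).const_add X
  convert! (hlin.fun_pow' (n + 1)).const_smul ((n + 1)! : ℂ)⁻¹ using 1
  simp only [zero_smul, add_zero, Nat.pred_succ]
  rw [sum_pow_mul_mul_pow_eq_sum_ad, smul_sum]
  refine sum_congr rfl fun m hm => ?_
  rw [← Nat.cast_smul_eq_nsmul ℂ, smul_smul, ← mem_antidiagonal.mp hm, add_right_comm,
    Nat.cast_add_choose]
  congr 1
  have : ((m.1 + 1 + m.2)! : ℂ) ≠ 0 := by exact_mod_cast Nat.factorial_ne_zero _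
  simp only [phiSeries, coeff_mk]
  field_simp

variable [CompleteSpace 𝔸]

theorem evalSeries_adCLM_apply_mul_exp {f : ℂ⟦X⟧} (hf : IsEntire f) (X Y : 𝔸) :
    evalSeries f (adCLM X) Y * NormedSpace.exp X =
      ∑' n, ∑ m ∈ antidiagonal n,
        (coeff m.1 f * (m.2 ! : ℂ)⁻¹) • ((ad X)^[m.1] Y * X ^ m.2) := by
  have hf' : Summable fun n => ‖coeff n f • (ad X)^[n] Y‖ := by
    refine ((hf.summable_norm (adCLM X)).mul_right ‖Y‖).of_nonneg_of_le
      (fun _ => norm_nonneg _) fun n => ?_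
    rw [← adCLM_pow_apply, ← smul_apply]
    exact ContinuousLinearMap.le_opNorm _ _
  have hf'' : evalSeries f (adCLM X) Y = ∑' n, coeff n f • (ad X)^[n] Y := by
    simp only [← adCLM_pow_apply]
    exact ((hf.hasSum (adCLM X)).mapL (ContinuousLinearMap.apply ℂ 𝔸 Y)).tsum_eq.symm
  rw [hf'', NormedSpace.exp_eq_tsum ℂ,
    tsum_mul_tsum_eq_tsum_sum_antidiagonal_of_summable_norm hf'
      (NormedSpace.norm_expSeries_summable' X)]
  simp only [smul_mul_smul_comm]

theorem exp_adCLM_apply_mul_exp (X Y : 𝔸) :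
    NormedSpace.exp (adCLM X) Y * NormedSpace.exp X = NormedSpace.exp X * Y := by
  rw [← evalSeries_exp, evalSeries_adCLM_apply_mul_exp isEntire_exp]
  have hexp := (NormedSpace.exp_series_hasSum_exp' (𝕂 := ℂ) X).mul_right Y
  rw [← hexp.tsum_eq]
  refine tsum_congr fun n => ?_
  rw [smul_mul_assoc, pow_mul_eq_sum_ad, smul_sum]
  refine sum_congr rfl fun m hm => ?_
  rw [← Nat.cast_smul_eq_nsmul ℂ, smul_smul, ← mem_antidiagonal.mp hm, Nat.cast_add_choose]
  congr 1
  have : ((m.1 + m.2)! : ℂ) ≠ 0 := by exact_mod_cast Nat.factorial_ne_zero _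
  simp only [coeff_exp, one_div, map_inv₀, map_natCast]
  field_simp

theorem hasDerivAt_exp_add_smul (X Y : 𝔸) :
    HasDerivAt (fun ζ : ℂ => NormedSpace.exp (X + ζ • Y))
      (evalSeries phiSeries (adCLM X) Y * NormedSpace.exp X) 0 := by
  have hdiff : DifferentiableAt ℂ (fun ζ : ℂ => NormedSpace.exp (X + ζ • Y)) 0 :=
    (NormedSpace.exp_analytic _).differentiableAt.comp (0 : ℂ) (by fun_prop)
  let F (n : ℕ) (ζ : ℂ) : 𝔸 := (n ! : ℂ)⁻¹ • (X + ζ • Y) ^ n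
  have hF : ∀ n, ∀ ζ ∈ Metric.ball (0 : ℂ) 1,
      ‖F n ζ‖ ≤ max 1 ‖(1 : 𝔸)‖ * (‖(n ! : ℂ)⁻¹‖ * (‖X‖ + ‖Y‖) ^ n) := fun n ζ hζ => by
    refine norm_smul_pow_le _ ((norm_add_le _ _).trans ?_) n
    gcongr
    rw [norm_smul]
    exact mul_le_of_le_one_left (norm_nonneg _) (mem_ball_zero_iff.mp hζ).le
  have hbound : Summable fun n : ℕ =>
      max 1 ‖(1 : 𝔸)‖ * (‖(n ! : ℂ)⁻¹‖ * (‖X‖ + ‖Y‖) ^ n) := by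
    refine Summable.mul_left _ ((isEntire_exp (‖X‖ + ‖Y‖)).congr fun n => ?_)
    simp [coeff_exp]
  have hsum := Complex.hasSum_deriv_of_summable_norm hbound
    (fun n => by unfold F; fun_prop) Metric.isOpen_ball hF (Metric.mem_ball_self one_pos)
  have hderiv : deriv (fun ζ : ℂ => NormedSpace.exp (X + ζ • Y)) 0 =
      evalSeries phiSeries (adCLM X) Y * NormedSpace.exp X := by
    have hexp : (fun ζ : ℂ => NormedSpace.exp (X + ζ • Y)) = fun ζ => ∑' n, F n ζ :=
      funext fun ζ => congr_fun (NormedSpace.exp_eq_tsum ℂ) _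
    rw [hexp, ← hsum.tsum_eq, hsum.summable.tsum_eq_zero_add,
      evalSeries_adCLM_apply_mul_exp isEntire_phiSeries]
    simp only [F, pow_zero, deriv_const, zero_add,
      (hasDerivAt_inv_factorial_smul_add_smul_pow X Y _).deriv]
  exact hderiv ▸ hdiff.hasDerivAt

end ExpDerivative

section SecondOrderExpansion

variable {R ι : Type*} [NormedRing R] {l : Filter ι} {t : ι → ℝ} {f g u v u' v' : ι → R}

/-- `f = 1 + u + v + O(t³)` with `u = O(t)` and `v = O(t²)`: the second-order Taylor expansion, in a
family of small elements of size `t`, of a product of exponentials. -/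
structure HasSecondOrderExpansion (l : Filter ι) (t : ι → ℝ) (f u v : ι → R) : Prop where
  isBigO_linear : u =O[l] t
  isBigO_quadratic : v =O[l] fun i => t i ^ 2
  isBigO_remainder : (fun i => f i - (1 + u i + v i)) =O[l] fun i => t i ^ 3

theorem HasSecondOrderExpansion.isBigO_one (hf : HasSecondOrderExpansion l t f u v)
    (ht : t =O[l] fun _ => (1 : ℝ)) : f =O[l] fun _ => (1 : ℝ) := by
  have htn (n : ℕ) : (fun i => t i ^ n) =O[l] fun _ => (1 : ℝ) := by simpa using ht.pow n
  have h := (hf.isBigO_remainder.trans (htn 3)).add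
    (((isBigO_const_const (1 : R) (one_ne_zero' ℝ) l).add (hf.isBigO_linear.trans ht)).add
      (hf.isBigO_quadratic.trans (htn 2)))
  exact h.congr_left fun i => sub_add_cancel _ _

theorem HasSecondOrderExpansion.mul (ht : t =O[l] fun _ => (1 : ℝ))
    (hf : HasSecondOrderExpansion l t f u v) (hg : HasSecondOrderExpansion l t g u' v') :
    HasSecondOrderExpansion l t (fun i => f i * g i) (fun i => u i + u' i)
      (fun i => v i + u i * u' i + v' i) where
  isBigO_linear := hf.isBigO_linear.add hg.isBigO_linear
  isBigO_quadratic := (hf.isBigO_quadratic.add (by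
    simpa only [sq] using hf.isBigO_linear.mul hg.isBigO_linear)).add hg.isBigO_quadratic
  isBigO_remainder := by
    have hf_poly : (fun i => 1 + u i + v i) =O[l] fun _ => (1 : ℝ) := by
      have ht2 : (fun i => t i ^ 2) =O[l] fun _ => (1 : ℝ) := by simpa using ht.pow 2
      exact ((isBigO_const_const (1 : R) (one_ne_zero' ℝ) l).add (hf.isBigO_linear.trans ht)).add
        (hf.isBigO_quadratic.trans ht2)
    have h₁ : (fun i => (f i - (1 + u i + v i)) * g i) =O[l] fun i => t i ^ 3 := by
      simpa using hf.isBigO_remainder.mul (hg.isBigO_one ht)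
    have h₂ : (fun i => (1 + u i + v i) * (g i - (1 + u' i + v' i))) =O[l] fun i => t i ^ 3 := by
      simpa using hf_poly.mul hg.isBigO_remainder
    have h₃ : (fun i => u i * v' i) =O[l] fun i => t i ^ 3 := by
      simpa only [pow_succ' _ 2] using hf.isBigO_linear.mul hg.isBigO_quadratic
    have h₄ : (fun i => v i * (u' i + v' i)) =O[l] fun i => t i ^ 3 := by
      have ht2 : (fun i => t i ^ 2) =O[l] t := by
        simpa only [sq, mul_one] using (isBigO_refl t l).mul ht
      simpa only [pow_succ _ 2] using
        hf.isBigO_quadratic.mul (hg.isBigO_linear.add (hg.isBigO_quadratic.trans ht2))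
    refine (((h₁.add h₂).add h₃).add h₄).congr_left fun i => ?_
    noncomm_ring

theorem HasSecondOrderExpansion.isBigO_sub (hf : HasSecondOrderExpansion l t f u v)
    (hg : HasSecondOrderExpansion l t g u v) : (fun i => f i - g i) =O[l] fun i => t i ^ 3 :=
  (hf.isBigO_remainder.sub hg.isBigO_remainder).congr_left fun _ => sub_sub_sub_cancel_right _ _ _

variable [NormedAlgebra ℂ R] [CompleteSpace R] {x : ι → R}

theorem hasSecondOrderExpansion_exp (ht : t =O[l] fun _ => (1 : ℝ)) (hx : x =O[l] t) :
    HasSecondOrderExpansion l t (fun i => NormedSpace.exp (x i)) x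
      (fun i => (1 / 2 : ℂ) • x i ^ 2) where
  isBigO_linear := hx
  isBigO_quadratic := by
    simpa only [Pi.smul_def] using (hx.pow 2).const_smul_left (1 / 2 : ℂ)
  isBigO_remainder := by
    refine (isBigO_exp_sub_aeval_trunc hx ht 3).congr_left fun i => ?_
    rw [Polynomial.aeval_def, eval₂_trunc_eq_sum_range]
    simp [sum_range_succ, coeff_exp, Algebra.smul_def]

theorem hasSecondOrderExpansion_exp_of_isBigO_sq (ht : t =O[l] fun _ => (1 : ℝ))
    (hx : x =O[l] fun i => t i ^ 2) :
    HasSecondOrderExpansion l t (fun i => NormedSpace.exp (x i)) (fun _ => 0) x where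
  isBigO_linear := isBigO_zero _ _
  isBigO_quadratic := hx
  isBigO_remainder := by
    have ht2 : (fun i => t i ^ 2) =O[l] fun _ => (1 : ℝ) := by simpa using ht.pow 2
    have ht4 : (fun i => (t i ^ 2) ^ 2) =O[l] fun i => t i ^ 3 :=
      ((isBigO_refl (fun i => t i ^ 3) l).mul ht).congr (fun i => by ring) fun i => mul_one _
    refine ((isBigO_exp_sub_aeval_trunc hx ht2 2).trans ht4).congr_left fun i => ?_
    rw [Polynomial.aeval_def, eval₂_trunc_eq_sum_range]
    simp [sum_range_succ, coeff_exp]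

end SecondOrderExpansion

section SplittingError

variable {𝔸 : Type*} [NormedRing 𝔸] [NormedAlgebra ℂ 𝔸]

/-- The error of the Strang splitting `exp (X/2) exp Y exp (X/2)` of `exp (X + Y)` after
conjugation by `exp C`. -/
noncomputable def splittingError (X Y C : 𝔸) : 𝔸 :=
  NormedSpace.exp (X + Y) - NormedSpace.exp C * (NormedSpace.exp ((1 / 2 : ℂ) • X) *
    NormedSpace.exp Y * NormedSpace.exp ((1 / 2 : ℂ) • X)) * NormedSpace.exp (-C)

variable [CompleteSpace 𝔸]

theorem isBigO_splittingError {ι : Type*} {l : Filter ι} {X Y C : ι → 𝔸} {t : ι → ℝ}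
    (ht : t =O[l] fun _ => (1 : ℝ)) (hX : X =O[l] t) (hY : Y =O[l] t)
    (hC : C =O[l] fun i => t i ^ 2) :
    (fun i => splittingError (X i) (Y i) (C i)) =O[l] fun i => t i ^ 3 := by
  have hX_half : (fun i => (1 / 2 : ℂ) • X i) =O[l] t := hX.const_smul_left (1 / 2 : ℂ)
  have hexp_half := hasSecondOrderExpansion_exp ht hX_half
  have hstrang := (hexp_half.mul ht (hasSecondOrderExpansion_exp ht hY)).mul ht hexp_half
  have hconj := ((hasSecondOrderExpansion_exp_of_isBigO_sq ht hC).mul ht hstrang).mul ht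
    (hasSecondOrderExpansion_exp_of_isBigO_sq ht hC.neg_left)
  refine (hasSecondOrderExpansion_exp ht (hX.add hY)).isBigO_sub ?_
  convert hconj using 2 with i i
  · module
  · simp only [zero_mul, mul_zero, add_zero, zero_add, sq, add_mul, mul_add, smul_mul_assoc,
      mul_smul_comm]
    module

end SplittingError

section FirstOrder

variable {𝔸 : Type*} [NormedRing 𝔸] [NormedAlgebra ℂ 𝔸] [CompleteSpace 𝔸]

theorem exp_half_smul_mul_self (X : 𝔸) :
    NormedSpace.exp ((1 / 2 : ℂ) • X) * NormedSpace.exp ((1 / 2 : ℂ) • X) =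
      NormedSpace.exp X := by
  let +nondep : NormedAlgebra ℚ 𝔸 := .restrictScalars ℚ ℂ 𝔸
  rw [← NormedSpace.exp_add_of_commute (.refl _), ← add_smul, add_halves, one_smul]

theorem exp_half_smul_mul_mul_exp_half_smul (X Y : 𝔸) :
    NormedSpace.exp ((1 / 2 : ℂ) • X) * Y * NormedSpace.exp ((1 / 2 : ℂ) • X) =
      NormedSpace.exp ((1 / 2 : ℂ) • adCLM X) Y * NormedSpace.exp X := by
  rw [← exp_adCLM_apply_mul_exp, map_smul, mul_assoc, exp_half_smul_mul_self]

theorem splittingError_zero_right (X : 𝔸) : splittingError X 0 0 = 0 := by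
  simp [splittingError, exp_half_smul_mul_self, -one_div]

theorem hasDerivAt_splittingError_smul (X Y C : 𝔸) :
    HasDerivAt (fun ζ : ℂ => splittingError X (ζ • Y) (ζ • C))
      (evalSeries phiSeries (adCLM X) Y * NormedSpace.exp X -
        (C * NormedSpace.exp X +
          NormedSpace.exp ((1 / 2 : ℂ) • X) * Y * NormedSpace.exp ((1 / 2 : ℂ) • X) -
          NormedSpace.exp X * C)) 0 := by
  have hexp (Z : 𝔸) : HasDerivAt (fun ζ : ℂ => NormedSpace.exp (ζ • Z)) Z 0 := by
    simpa using hasDerivAt_exp_smul_const Z (0 : ℂ)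
  have hexp_neg : HasDerivAt (fun ζ : ℂ => NormedSpace.exp (-(ζ • C))) (-C) 0 := by
    simpa using hexp (-C)
  have hstrang := ((hexp Y).const_mul (NormedSpace.exp ((1 / 2 : ℂ) • X))).mul_const
    (NormedSpace.exp ((1 / 2 : ℂ) • X))
  convert! (hasDerivAt_exp_add_smul X Y).sub (((hexp C).mul hstrang).mul hexp_neg) using 1
  simp [exp_half_smul_mul_self, sub_eq_add_neg, -one_div]

theorem hasDerivAt_splittingError_smul_aeval (p : Polynomial ℂ) (X Y : 𝔸) :
    HasDerivAt (fun ζ : ℂ => splittingError X (ζ • Y) (ζ • Polynomial.aeval (adCLM X) p Y))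
      (evalSeries (firstOrderSeries p) (adCLM X) Y * NormedSpace.exp X) 0 := by
  convert! hasDerivAt_splittingError_smul X Y (Polynomial.aeval (adCLM X) p Y) using 1
  rw [evalSeries_firstOrderSeries, exp_half_smul_mul_mul_exp_half_smul, ← exp_adCLM_apply_mul_exp]
  simp only [sub_apply, mul_apply_eq_comp, one_apply_eq_self, sub_mul]
  abel

theorem differentiable_splittingError_smul (X Y C : 𝔸) :
    Differentiable ℂ fun ζ : ℂ => splittingError X (ζ • Y) (ζ • C) := by
  have hexp : Differentiable ℂ (NormedSpace.exp : 𝔸 → 𝔸) := fun x =>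
    (NormedSpace.exp_analytic x).differentiableAt
  unfold splittingError
  fun_prop

end FirstOrder

section Schwarz

variable {E : Type*} [NormedAddCommGroup E] [NormedSpace ℂ E]

theorem norm_sub_sub_smul_deriv_le {f : ℂ → E} {c z : ℂ} {R S : ℝ}
    (hd : DifferentiableOn ℂ f (Metric.ball c R))
    (h_maps : Set.MapsTo f (Metric.ball c R) (Metric.closedBall (f c) S))
    (hz : z ∈ Metric.ball c R) :
    ‖f z - f c - (z - c) • deriv f c‖ ≤ 2 * S * (‖z - c‖ / R) ^ 2 := by
  have hR : 0 < R := Metric.nonempty_ball.mp ⟨z, hz⟩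
  have hf' := Complex.norm_deriv_le_div_of_mapsTo_ball hd h_maps hR
  let g (w : ℂ) : E := f w - (w - c) • deriv f c
  have hgc : g c = f c := by simp [g]
  have hg_sub (w : ℂ) : g w - g c = f w - f c - (w - c) • deriv f c := by
    rw [hgc, sub_right_comm]
  have hg_maps : Set.MapsTo g (Metric.ball c R) (Metric.closedBall (g c) (2 * S)) := by
    intro w hw
    have hwR : ‖w - c‖ ≤ R := (mem_ball_iff_norm.mp hw).le
    rw [mem_closedBall_iff_norm, hg_sub]
    calc ‖f w - f c - (w - c) • deriv f c‖ ≤ ‖f w - f c‖ + ‖w - c‖ * ‖deriv f c‖ :=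
          (norm_sub_le _ _).trans_eq (by rw [norm_smul])
      _ ≤ S + R * (S / R) := by
          gcongr
          exact mem_closedBall_iff_norm.mp (h_maps hw)
      _ = 2 * S := by field_simp; ring
  have hg_small : (g · - g c) =o[nhds c] fun w => ‖w - c‖ ^ 1 := by
    have hderiv := (hd.differentiableAt (Metric.ball_mem_nhds c hR)).hasDerivAt
    simpa only [hg_sub, pow_one, isLittleO_norm_right] using hasDerivAt_iff_isLittleO.mp hderiv
  have h := Complex.dist_le_mul_div_pow_of_mapsTo_ball_of_isLittleO
    (show DifferentiableOn ℂ g _ from hd.sub (by fun_prop)) hg_maps hg_small hz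
  rwa [dist_eq_norm, dist_eq_norm, hg_sub] at h

theorem isBigO_sub_smul_of_hasDerivAt {ι : Type*} {l : Filter ι} {f : ι → ℂ → E} {f' : ι → E}
    {a : ι → ℂ} {b : ι → ℝ} (hd : ∀ i, Differentiable ℂ (f i)) (h₀ : ∀ i, f i 0 = 0)
    (hf' : ∀ i, HasDerivAt (f i) (f' i) 0)
    (hb : ∀ R, (fun p : ι × ℂ => f p.1 p.2) =O[l ×ˢ 𝓟 (Metric.ball 0 R)] fun p => b p.1)
    (ha : a =O[l] fun _ => (1 : ℝ)) :
    (fun i => f i (a i) - a i • f' i) =O[l] fun i => ‖a i‖ ^ 2 * b i := by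
  obtain ⟨r, har⟩ := ha.bound
  obtain ⟨K, hK⟩ := (hb (r + 1)).bound
  refine IsBigO.of_bound (2 * K / (r + 1) ^ 2) ?_
  filter_upwards [har, eventually_prod_principal_iff.mp hK] with i hai hbi
  rw [norm_one, mul_one] at hai
  have h_maps : Set.MapsTo (f i) (Metric.ball 0 (r + 1))
      (Metric.closedBall (f i 0) (K * ‖b i‖)) := fun ζ hζ => by
    simpa [h₀] using hbi ζ hζ
  have h := norm_sub_sub_smul_deriv_le (hd i).differentiableOn h_maps
    (mem_ball_zero_iff.mpr (hai.trans_lt (lt_add_one r)))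
  rw [h₀, sub_zero, sub_zero, (hf' i).deriv] at h
  calc ‖f i (a i) - a i • f' i‖ ≤ 2 * (K * ‖b i‖) * (‖a i‖ / (r + 1)) ^ 2 := h
    _ = 2 * K / (r + 1) ^ 2 * ‖‖a i‖ ^ 2 * b i‖ := by
      rw [norm_mul, norm_pow, norm_norm, div_pow]
      ring

end Schwarz

section ErrorBound

variable {𝔸 : Type*} [NormedRing 𝔸] [NormedAlgebra ℂ 𝔸] {ι : Type*} {l : Filter ι}
  {x y : ι → 𝔸} {t : ι → ℝ}

theorem isBigO_clm_apply {𝕜 E F : Type*} [NontriviallyNormedField 𝕜] [SeminormedAddCommGroup E]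
    [SeminormedAddCommGroup F] [NormedSpace 𝕜 E] [NormedSpace 𝕜 F] {T : ι → E →L[𝕜] F} {y : ι → E}
    {g h : ι → ℝ} (hT : T =O[l] g) (hy : y =O[l] h) :
    (fun i => T i (y i)) =O[l] fun i => g i * h i :=
  (isBigO_of_le l fun i => by simpa using (T i).le_opNorm (y i)).trans
    (hT.norm_left.mul hy.norm_left)

variable [CompleteSpace 𝔸]

theorem isBigO_evalSeries_adCLM_apply {f : ℂ⟦X⟧} (hf : IsEntire f) {m : ℕ} (hm : X ^ m ∣ f)
    (ht : t =O[l] fun _ => (1 : ℝ)) (hx : x =O[l] t) (hy : y =O[l] t) :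
    (fun i => evalSeries f (adCLM (x i)) (y i)) =O[l] fun i => t i ^ (m + 1) := by
  have hadx : (fun i => adCLM (x i)) =O[l] t := (adCLM.isBigO_comp x l).trans hx
  simpa only [pow_succ] using isBigO_clm_apply (hf.isBigO_pow_of_X_pow_dvd hm hadx ht) hy

theorem isBigO_aeval_adCLM_apply {p : Polynomial ℂ} (hp : Polynomial.X ∣ p)
    (ht : t =O[l] fun _ => (1 : ℝ)) (hx : x =O[l] t) (hy : y =O[l] t) :
    (fun i => Polynomial.aeval (adCLM (x i)) p (y i)) =O[l] fun i => t i ^ 2 := by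
  have hp' : X ^ 1 ∣ (p : ℂ⟦X⟧) := by
    obtain ⟨q, rfl⟩ := hp
    simp
  simpa only [evalSeries_coe] using isBigO_evalSeries_adCLM_apply (isEntire_coe p) hp' ht hx hy

variable {p : Polynomial ℂ} {a : ι → ℂ}

theorem isBigO_splittingError_smul_aeval_sub (hp : Polynomial.X ∣ p)
    (ht : t =O[l] fun _ => (1 : ℝ)) (hx : x =O[l] t) (hy : y =O[l] t)
    (ha : a =O[l] fun _ => (1 : ℝ)) :
    (fun i => splittingError (x i) (a i • y i) (a i • Polynomial.aeval (adCLM (x i)) p (y i)) -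
      a i • (evalSeries (firstOrderSeries p) (adCLM (x i)) (y i) * NormedSpace.exp (x i)))
      =O[l] fun i => ‖a i‖ ^ 2 * t i ^ 3 := by
  have hc := isBigO_aeval_adCLM_apply hp ht hx hy
  refine isBigO_sub_smul_of_hasDerivAt (b := fun i => t i ^ 3)
    (f := fun i ζ => splittingError (x i) (ζ • y i) (ζ • Polynomial.aeval (adCLM (x i)) p (y i)))
    (fun i => differentiable_splittingError_smul _ _ _)
    (fun i => by simp only [zero_smul, splittingError_zero_right])
    (fun i => hasDerivAt_splittingError_smul_aeval p _ _) (fun R => ?_) ha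
  have hζ : (fun q : ι × ℂ => q.2) =O[l ×ˢ 𝓟 (Metric.ball 0 R)] fun _ => (1 : ℝ) :=
    IsBigO.of_bound R <| eventually_prod_principal_iff.mpr <| .of_forall fun i ζ hζ => by
      simpa using (mem_ball_zero_iff.mp hζ).le
  have hfst : Tendsto Prod.fst (l ×ˢ 𝓟 (Metric.ball (0 : ℂ) R)) l := tendsto_fst
  refine isBigO_splittingError (ht.comp_tendsto hfst) (hx.comp_tendsto hfst) ?_ ?_
  · simpa using hζ.smul (hy.comp_tendsto hfst)
  · simpa using hζ.smul (hc.comp_tendsto hfst)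

theorem isBigO_splittingError_smul_aeval {m : ℕ} (hp : Polynomial.X ∣ p)
    (hm : X ^ m ∣ firstOrderSeries p) (ht : t =O[l] fun _ => (1 : ℝ)) (hx : x =O[l] t)
    (hy : y =O[l] t) (ha : a =O[l] fun _ => (1 : ℝ)) :
    (fun i => splittingError (x i) (a i • y i) (a i • Polynomial.aeval (adCLM (x i)) p (y i)))
      =O[l] fun i => ‖a i‖ ^ 2 * |t i| ^ 3 + ‖a i‖ * |t i| ^ (m + 1) := by
  have hfirst : (fun i => a i • (evalSeries (firstOrderSeries p) (adCLM (x i)) (y i) *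
      NormedSpace.exp (x i))) =O[l] fun i => ‖a i‖ * t i ^ (m + 1) := by
    have hexp : (fun i => NormedSpace.exp (x i)) =O[l] fun _ => (1 : ℝ) := by
      simpa only [evalSeries_exp] using isEntire_exp.isBigO_one (hx.trans ht)
    have hseries := isBigO_evalSeries_adCLM_apply (isEntire_firstOrderSeries p) hm ht hx hy
    simpa using (isBigO_refl a l).norm_right.smul (hseries.mul hexp)
  simpa using (isBigO_splittingError_smul_aeval_sub hp ht hx hy ha).add_add hfirst

end ErrorBound

section CorrectedFormula

variable {𝔸 : Type*} [NormedRing 𝔸] [NormedAlgebra ℂ 𝔸]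

theorem corrector_eq_aeval (A B : 𝔸) (α : ℝ) (k : ℕ) (z : ℂ) :
    corrector A B α k z =
      (α : ℂ) • Polynomial.aeval (adCLM (z • A)) (correctorPoly k) (z • B) := by
  rw [corrector, correctorPoly, map_sum, _root_.sum_apply]
  congr 1
  refine sum_congr rfl fun j hj => ?_
  have hj' : 2 * j - 1 + 1 = 2 * j := by rw [mem_Icc] at hj; omega
  rw [map_mul, Polynomial.aeval_C, map_pow, Polynomial.aeval_X, ← Algebra.smul_def,
    _root_.smul_apply, map_smul, adCLM_pow_apply, ad_smul_iterate, smul_smul, smul_smul, mul_assoc,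
    ← pow_succ', hj']

theorem exp_sub_correctedS₂_eq_splittingError (A B : 𝔸) (α : ℝ) (k : ℕ) (z : ℂ) :
    NormedSpace.exp (z • hamiltonian A B α) - correctedS₂ A B α k z =
      splittingError (z • A) ((α : ℂ) • z • B)
        ((α : ℂ) • Polynomial.aeval (adCLM (z • A)) (correctorPoly k) (z • B)) := by
  rw [splittingError, correctedS₂, S₂, corrector_eq_aeval, hamiltonian, smul_add, smul_comm z,
    smul_smul (α : ℂ), smul_smul (1 / 2 : ℂ), one_div_mul_eq_div]

end CorrectedFormula

end CorrectedPF

open CorrectedPF Asymptotics Filter in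
theorem mainTheorem1_general {𝔸 : Type*} [NormedRing 𝔸] [NormedAlgebra ℂ 𝔸] [CompleteSpace 𝔸]
    (k : ℕ) (M a r : ℝ) :
    ∃ K : ℝ, ∀ A B : 𝔸, ‖A‖ ≤ M → ‖B‖ ≤ M →
      ∀ (α : ℝ) (z : ℂ), |α| ≤ a → ‖z‖ ≤ r →
        ‖NormedSpace.exp (z • CorrectedPF.hamiltonian A B α) -
            CorrectedPF.correctedS₂ A B α k z‖ ≤
          K * (α ^ 2 * ‖z‖ ^ 3 + |α| * ‖z‖ ^ (2 * k + 3)) := by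
  let s : Set (𝔸 × 𝔸 × ℝ × ℂ) := {q | ‖q.1‖ ≤ M ∧ ‖q.2.1‖ ≤ M ∧ |q.2.2.1| ≤ a ∧ ‖q.2.2.2‖ ≤ r}
  have hα : (fun q : 𝔸 × 𝔸 × ℝ × ℂ => (q.2.2.1 : ℂ)) =O[𝓟 s] fun _ => (1 : ℝ) :=
    isBigO_principal.mpr ⟨a, fun q hq => by simpa using hq.2.2.1⟩
  have hz : (fun q : 𝔸 × 𝔸 × ℝ × ℂ => ‖q.2.2.2‖) =O[𝓟 s] fun _ => (1 : ℝ) :=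
    isBigO_principal.mpr ⟨r, fun q hq => by simpa using hq.2.2.2⟩
  have hsmul (X : 𝔸 × 𝔸 × ℝ × ℂ → 𝔸) (hX : ∀ q ∈ s, ‖X q‖ ≤ M) :
      (fun q => q.2.2.2 • X q) =O[𝓟 s] fun q => ‖q.2.2.2‖ :=
    isBigO_principal.mpr ⟨M, fun q hq => by
      rw [norm_norm, mul_comm]
      exact (norm_smul_le _ _).trans (by gcongr; exact hX q hq)⟩
  obtain ⟨K, hK⟩ := isBigO_principal.mp <|
    isBigO_splittingError_smul_aeval (X_dvd_correctorPoly k)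
      (X_pow_dvd_firstOrderSeries k) hz
      (hsmul Prod.fst fun _ hq => hq.1) (hsmul (fun q => q.2.1) fun _ hq => hq.2.1) hα
  refine ⟨K, fun A B hA hB α z hα hz => ?_⟩
  rw [exp_sub_correctedS₂_eq_splittingError]
  refine (hK (A, B, α, z) ⟨hA, hB, hα, hz⟩).trans_eq ?_
  rw [Real.norm_of_nonneg (by positivity)]
  simp

theorem mainTheorem1 {𝔸 : Type*} [NormedRing 𝔸] [NormedAlgebra ℂ 𝔸] [CompleteSpace 𝔸]
    (k : ℕ) (hk : 1 ≤ k) (M : ℝ) :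
    ∃ K : ℝ, ∀ A B : 𝔸, ‖A‖ ≤ M → ‖B‖ ≤ M →
      ∀ (α : ℝ) (z : ℂ), 0 < α → α ≤ 1 → ‖z‖ < 1 →
        ‖NormedSpace.exp (z • CorrectedPF.hamiltonian A B α) -
            CorrectedPF.correctedS₂ A B α k z‖ ≤
          K * (α ^ 2 * ‖z‖ ^ 3 + α * ‖z‖ ^ (2 * k + 3)) := by
  obtain ⟨K, hK⟩ := mainTheorem1_general (𝔸 := 𝔸) k M 1 1
  exact ⟨K, fun A B hA hB α z hα hα1 hz => by
    simpa [abs_of_pos hα] using hK A B hA hB α z (by rwa [abs_of_pos hα]) hz.le⟩
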